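/- Let $k\ge 3$, $n\ge k$, and let $G=(V,E)$ be a $k$-uniform hypergraph with vertex set $V=[n]$, i.e. $E$ is a set of $k$-element subsets of $V$. Let $d_i$ be the number of edges containing $i$. Let $\mathcal A$ be the $k$-th order $n$-dimensional tensor with entries $a_{i_1\ldots i_k}=\frac1{(k-1)!}$ if $\{i_1,\ldots,i_k\}\in E$ and $0$ otherwise, let $\mathcal D$ be the diagonal tensor with diagonal entries $d_1,\ldots,d_n$, and let $\mathcal L=\mathcal D-\mathcal A$ and $\mathcal Q=\mathcal D+\mathcal A$ be the Laplacian and signless Laplacian tensors of $G$. For a real $k$-th order $n$-dimensional tensor $\mathcal T$ and $\mathbf x\in\mathbb R^n$, let $\mathcal T\mathbf x^{k-1}\in\mathbb R^n$ be the vector with entries $(\mathcal T\mathbf x^{k-1})_i=\sum_{i_2,\ldots,i_k\in[n]}t_{ii_2\ldots i_k}x_{i_2}\cdots x_{i_k}$. A real number $\lambda$ is an H-eigenvalue of $\mathcal T$ if $(\lambda\mathcal I-\mathcal T)\mathbf x^{k-1}=0$ for some $\mathbf x\in\mathbb R^n\setminus\{0\}$, where $\mathcal I$ is the identity tensor (with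 entry $1$ if $i_1=\cdots=i_k$ and $0$ otherwise), and $\lambda(\mathcal T)$ denotes the largest H-eigenvalue of $\mathcal T$. Call $G$ connected if for any two different vertices $i,j$ there are edges $e_1,\ldots,e_m$ with $i\in e_1$, $j\in e_m$ and $e_r\cap e_{r+1}\ne\emptyset$ for $1\le r<m$. For $k$ even, call $G$ odd-bipartite if $E=\emptyset$ or $V$ is a disjoint union of two nonempty sets $V_1,V_2$ such that $|e\cap V_1|$ is odd for every $e\in E$. Theorem. The largest H-eigenvalues $\lambda(\mathcal L)$ and $\lambda(\mathcal Q)$ exist, and $$\lambda(\mathcal L)\le\lambda(\mathcal Q).$$ If furthermore $G$ is connected, then $\lambda(\mathcal L)=\lambda(\mathcal Q)$ if and only if $k$ is even and $G$ is odd-bipartite. If $k$ is odd and $G$ is connected and has at least one edge, then $\lambda(\mathcal L)<\lambda(\mathcal Q)$. -/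

import Mathlib

noncomputable section

namespace Hypergraph

/-! ### Real tensors and their H-eigenvalues -/

/-- Real tensors `(t_{i_1 … i_k})` of order `k` whose indices range over `V`. -/
abbrev RealTensor (V : Type*) (k : ℕ) : Type _ := (Fin k → V) → ℝ

section Tensor

variable {V : Type*} [Fintype V] {k : ℕ}

/-- The vector `T x^{k-1}` (for `k ≥ 1`), whose `i`-th entry is
`∑_{i_2, …, i_k} t_{i i_2 … i_k} x_{i_2} ⋯ x_{i_k}`. Here `g = (i_2, …, i_k)`, and the index
`(i, i_2, …, i_k)` is `Fin.cons i g`; the cast only identifies `Fin k` with `Fin (k - 1 + 1)`. -/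
def RealTensor.applyPow (T : RealTensor V k) (x : V → ℝ) : V → ℝ := fun i =>
  ∑ g : Fin (k - 1) → V,
    T (fun j => (Fin.cons i g : Fin (k - 1 + 1) → V) (Fin.castLE (by omega) j)) * ∏ j, x (g j)

open Classical in
/-- The diagonal tensor of order `k ≥ 1` with diagonal entries `t_{i … i} = d i`. -/
def diagonalTensor (k : ℕ) (d : V → ℝ) : RealTensor V k := fun f =>
  ∑ i, if ∀ j, f j = i then d i else 0

/-- The identity tensor: `1` on the diagonal and `0` elsewhere. -/
def identityTensor (V : Type*) [Fintype V] (k : ℕ) : RealTensor V k :=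
  diagonalTensor k (fun _ => 1)

/-- `μ` is an H-eigenvalue of `T` if `(μ I - T) x^{k-1} = 0` for some nonzero real vector `x`. -/
def RealTensor.IsHEigenvalue (T : RealTensor V k) (μ : ℝ) : Prop :=
  ∃ x : V → ℝ, x ≠ 0 ∧ RealTensor.applyPow (μ • identityTensor V k - T) x = 0

/-- The set of all H-eigenvalues of `T`. -/
def RealTensor.hEigenvalues (T : RealTensor V k) : Set ℝ := {μ | T.IsHEigenvalue μ}

/-- The largest H-eigenvalue `λ(T)`, meaningful when `T.hEigenvalues` has a greatest element. -/
def RealTensor.largestHEigenvalue (T : RealTensor V k) : ℝ := sSup T.hEigenvalues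

end Tensor

/-! ### Uniform hypergraphs -/

section Hypergraph

variable {V : Type*}

/-- `H` is `k`-uniform: every edge has exactly `k` vertices (used for `k ≥ 3`, so that
`Set.ncard e = k` forces `e` to be finite). -/
def IsUniform (H : Hypergraph V) (k : ℕ) : Prop := ∀ e ∈ H.edgeSet, e.ncard = k

/-- Two vertices are connected if there is a sequence of edges `e 0, …, e m`, consecutive ones
intersecting, the first one containing `i` and the last one containing `j`. -/
def ConnectedPair (H : Hypergraph V) (i j : V) : Prop :=
  ∃ (m : ℕ) (e : ℕ → Set V), (∀ r ≤ m, e r ∈ H.edgeSet) ∧ i ∈ e 0 ∧ j ∈ e m ∧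
    ∀ r < m, (e r ∩ e (r + 1)).Nonempty

/-- Every pair of different vertices is connected. -/
def IsConnected (H : Hypergraph V) : Prop :=
  ∀ i ∈ H.vertexSet, ∀ j ∈ H.vertexSet, i ≠ j → H.ConnectedPair i j

/-- Odd-bipartiteness (a notion for `k`-uniform hypergraphs with `k` even): there are no edges, or
the vertex set splits into two disjoint nonempty parts `V₁`, `V₂` such that every edge meets `V₁`
in an odd number of vertices. -/
def IsOddBipartite (H : Hypergraph V) : Prop :=
  H.edgeSet = ∅ ∨ ∃ V₁ V₂ : Set V, V₁.Nonempty ∧ V₂.Nonempty ∧ Disjoint V₁ V₂ ∧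
    V₁ ∪ V₂ = H.vertexSet ∧ ∀ e ∈ H.edgeSet, Odd (e ∩ V₁).ncard

/-- The degree of a vertex: the number of edges containing it. -/
def degree (H : Hypergraph V) (i : V) : ℕ := {e ∈ H.edgeSet | i ∈ e}.ncard

open Classical in
/-- The adjacency tensor: the `(i_1, …, i_k)` entry is `1 / (k-1)!` if `{i_1, …, i_k}` is an edge,
and `0` otherwise. -/
def adjacencyTensor (H : Hypergraph V) (k : ℕ) : RealTensor V k := fun f =>
  if Set.range f ∈ H.edgeSet then 1 / ((k - 1).factorial : ℝ) else 0

/-- The diagonal tensor `D` of the vertex degrees. -/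
def degreeTensor [Fintype V] (H : Hypergraph V) (k : ℕ) : RealTensor V k :=
  diagonalTensor k (fun i => (H.degree i : ℝ))

/-- The Laplacian tensor `L = D - A`. -/
def laplacianTensor [Fintype V] (H : Hypergraph V) (k : ℕ) : RealTensor V k :=
  H.degreeTensor k - H.adjacencyTensor k

/-- The signless Laplacian tensor `Q = D + A`. -/
def signlessLaplacianTensor [Fintype V] (H : Hypergraph V) (k : ℕ) : RealTensor V k :=
  H.degreeTensor k + H.adjacencyTensor k

end Hypergraph

end Hypergraph

end

noncomputable section

open Finset

namespace Hypergraph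

/-! ### Tensors applied to vectors -/

namespace RealTensor

variable {V : Type*} [Fintype V] {n : ℕ}

/-! Write k = n + 1. For a k-uniform hypergraph, entry i of the adjacency tensor applied to x is
`linkSum`: the sum, over edges e through i, of the product of x over e without i. Let ρ be the
maximum over nonzero x ≥ 0 of `form` divided by ∑ x_v^k. Varying one coordinate at a time shows that
a maximizer is an eigenvector of Q for ρ (`IsFormBound.eigen_of_form_eq`). Conversely, an
eigenvector x of Q or L for μ satisfies (μ - d_i) x_i^n = ± linkSum. Taking absolute values,
multiplying by |x_i| and summing gives μ ∑ |x_v|^k ≤ form(|x|) ≤ ρ ∑ |x_v|^k (`le_form_abs`). Hence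
ρ = λ(Q) and λ(L) ≤ ρ.

If G is connected and ρ is an eigenvalue of L with eigenvector x, then |x| is a maximizer, so it has
no zero entry (`IsFormBound.pos_of_form_eq`) and solves the Q-equation. Comparison with the
L-equation for x forces equality in the triangle inequality, which fixes the sign of every term. For
k even, every edge product is negative, so {x < 0} is an odd bipartition; for k odd, the signs are
contradictory. Conversely, an odd bipartition gives a sign change carrying eigenvectors of Q to
eigenvectors of L. -/

lemma applyPow_succ (T : RealTensor V (n + 1)) (x : V → ℝ) (i : V) :
    T.applyPow x i = ∑ g : Fin n → V, T (Fin.cons i g) * ∏ j, x (g j) := rfl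

lemma applyPow_diagonalTensor (d : V → ℝ) (x : V → ℝ) (i : V) :
    RealTensor.applyPow (diagonalTensor (n + 1) d) x i = d i * x i ^ n := by
  classical
  rw [applyPow_succ, Finset.sum_eq_single (fun _ => i)]
  · simp only [diagonalTensor, prod_const, card_univ, Fintype.card_fin]
    congr 1
    rw [Finset.sum_eq_single i]
    · rw [if_pos]
      intro j
      refine Fin.cases ?_ ?_ j <;> simp
    · intro b _ hb
      rw [if_neg]
      intro h
      exact hb (by simpa using (h 0).symm)
    · simp
  · intro g _ hg
    simp only [diagonalTensor]
    rw [Finset.sum_eq_zero, zero_mul]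
    intro b _
    rw [if_neg]
    intro h
    apply hg
    funext j
    have h0 := h 0
    have hj := h j.succ
    simp only [Fin.cons_zero, Fin.cons_succ] at h0 hj
    rw [h0, hj]
  · simp

lemma applyPow_add (S T : RealTensor V (n + 1)) (x : V → ℝ) (i : V) :
    RealTensor.applyPow (S + T) x i = S.applyPow x i + T.applyPow x i := by
  simp only [applyPow_succ, Pi.add_apply, add_mul, Finset.sum_add_distrib]

lemma applyPow_sub (S T : RealTensor V (n + 1)) (x : V → ℝ) (i : V) :
    RealTensor.applyPow (S - T) x i = S.applyPow x i - T.applyPow x i := by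
  simp only [applyPow_succ, Pi.sub_apply, sub_mul, Finset.sum_sub_distrib]

lemma applyPow_smul (c : ℝ) (T : RealTensor V (n + 1)) (x : V → ℝ) (i : V) :
    RealTensor.applyPow (c • T) x i = c * T.applyPow x i := by
  simp only [applyPow_succ, Pi.smul_apply, smul_eq_mul, mul_assoc, Finset.mul_sum]

lemma applyPow_smul_vec (c : ℝ) (T : RealTensor V (n + 1)) (x : V → ℝ) (i : V) :
    T.applyPow (c • x) i = c ^ n * T.applyPow x i := by
  simp only [applyPow_succ, Pi.smul_apply, smul_eq_mul, Finset.mul_sum, Finset.prod_mul_distrib,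
    prod_const, card_univ, Fintype.card_fin]
  exact Finset.sum_congr rfl fun g _ => by ring

lemma continuous_applyPow (T : RealTensor V (n + 1)) (i : V) :
    Continuous fun x : V → ℝ => T.applyPow x i := by
  simp only [applyPow_succ]
  fun_prop

lemma isHEigenvalue_iff (T : RealTensor V (n + 1)) (μ : ℝ) :
    T.IsHEigenvalue μ ↔ ∃ x : V → ℝ, x ≠ 0 ∧ ∀ i, T.applyPow x i = μ * x i ^ n := by
  unfold RealTensor.IsHEigenvalue
  refine exists_congr fun x => and_congr_right fun _ => ?_
  rw [funext_iff]
  refine forall_congr' fun i => ?_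
  rw [applyPow_sub, applyPow_smul, identityTensor, applyPow_diagonalTensor, Pi.zero_apply,
    sub_eq_zero, one_mul, eq_comm]

/-- Eigenvectors may be taken of norm one. -/
lemma isHEigenvalue_iff_norm_eq_one (T : RealTensor V (n + 1)) (μ : ℝ) :
    T.IsHEigenvalue μ ↔ ∃ x : V → ℝ, ‖x‖ = 1 ∧ ∀ i, T.applyPow x i = μ * x i ^ n := by
  rw [isHEigenvalue_iff]
  constructor
  · rintro ⟨x, hx, h⟩
    refine ⟨‖x‖⁻¹ • x, by rw [norm_smul, norm_inv, norm_norm, inv_mul_cancel₀ (norm_ne_zero_iff.2 hx)], fun i => ?_⟩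
    rw [applyPow_smul_vec, h, Pi.smul_apply, smul_eq_mul, mul_pow]
    ring
  · rintro ⟨x, hx, h⟩
    exact ⟨x, fun h0 => by simp [h0] at hx, h⟩

/-- Read the equation at a coordinate where a normalized eigenvector has modulus 1. Summing over all
i makes the bound independent of that coordinate. -/
lemma abs_le_of_isHEigenvalue (T : RealTensor V (n + 1)) {μ : ℝ} (h : T.IsHEigenvalue μ) :
    |μ| ≤ ∑ i, ∑ g : Fin n → V, |T (Fin.cons i g)| := by
  obtain ⟨x, hx, h⟩ := (isHEigenvalue_iff_norm_eq_one T μ).1 h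
  have hne : Nonempty V := by
    by_contra hV
    rw [not_nonempty_iff] at hV
    simp [Subsingleton.elim x 0] at hx
  obtain ⟨i, hi⟩ := Finite.exists_max fun i => ‖x i‖
  have hi1 : ‖x i‖ = 1 := le_antisymm (hx ▸ norm_le_pi_norm x i)
    (hx ▸ (pi_norm_le_iff_of_nonneg (norm_nonneg _)).2 hi)
  have hle : ∀ j, |x j| ≤ 1 := fun j => hx ▸ norm_le_pi_norm x j
  calc |μ| = |T.applyPow x i| := by
        rw [h, abs_mul, abs_pow, ← Real.norm_eq_abs (x i), hi1, one_pow, mul_one]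
    _ ≤ ∑ g : Fin n → V, |T (Fin.cons i g) * ∏ j, x (g j)| := by
        rw [applyPow_succ]; exact Finset.abs_sum_le_sum_abs _ _
    _ ≤ ∑ g : Fin n → V, |T (Fin.cons i g)| := by
        refine Finset.sum_le_sum fun g _ => ?_
        rw [abs_mul, Finset.abs_prod]
        exact mul_le_of_le_one_right (abs_nonneg _)
          (Finset.prod_le_one (fun _ _ => abs_nonneg _) fun _ _ => hle _)
    _ ≤ _ := Finset.single_le_sum
        (f := fun i => ∑ g : Fin n → V, |T (Fin.cons i g)|)
        (fun _ _ => Finset.sum_nonneg fun _ _ => abs_nonneg _) (Finset.mem_univ i)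

/-- The spectrum is the projection of the compact set of pairs (eigenvalue, unit eigenvector), so a
largest eigenvalue exists as soon as there is one. -/
lemma isCompact_hEigenvalues (T : RealTensor V (n + 1)) : IsCompact T.hEigenvalues := by
  let C := ∑ i, ∑ g : Fin n → V, |T (Fin.cons i g)|
  let K : Set (ℝ × (V → ℝ)) := (Set.Icc (-C) C ×ˢ Metric.sphere 0 1) ∩
    {p | ∀ i, T.applyPow p.2 i = p.1 * p.2 i ^ n}
  have hK : IsCompact K := by
    refine (isCompact_Icc.prod (isCompact_sphere _ _)).inter_right ?_
    simp only [Set.ofPred_forall]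
    refine isClosed_iInter fun i => isClosed_eq ?_ (by fun_prop)
    exact (continuous_applyPow T i).comp continuous_snd
  convert hK.image continuous_fst
  ext μ
  constructor
  · intro h
    obtain ⟨x, hx, hx'⟩ := (isHEigenvalue_iff_norm_eq_one T μ).1 h
    exact ⟨(μ, x), ⟨⟨abs_le.1 (abs_le_of_isHEigenvalue T h), by simpa using hx⟩, hx'⟩, rfl⟩
  · rintro ⟨⟨_, x⟩, ⟨⟨_, hx⟩, hx'⟩, rfl⟩
    exact (isHEigenvalue_iff_norm_eq_one T _).2 ⟨x, by simpa using hx, hx'⟩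

lemma isGreatest_largestHEigenvalue (T : RealTensor V (n + 1)) (h : T.hEigenvalues.Nonempty) :
    IsGreatest T.hEigenvalues T.largestHEigenvalue :=
  (isCompact_hEigenvalues T).isGreatest_sSup h

end RealTensor

/-! ### The adjacency tensor in terms of edges -/

section Edges

variable {V : Type*} {n : ℕ}

/-- With only n slots, g cannot spend one on i and still cover the other n vertices of e. -/
lemma insert_image_eq_iff [DecidableEq V] {e : Finset V} {i : V} (he : e.card = n + 1)
    (hi : i ∈ e) (g : Fin n → V) : insert i (univ.image g) = e ↔ univ.image g = e.erase i := by
  constructor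
  · intro h
    symm
    apply Finset.eq_of_subset_of_card_le
    · rw [← h]
      intro v hv
      simpa [(mem_erase.1 hv).1] using (mem_erase.1 hv).2
    · rw [card_erase_of_mem hi, he]
      exact card_image_le.trans (by simp)
  · intro h
    rw [h, insert_erase hi]

/-- The sum over the edges containing `i` of the products over the other vertices. -/
def linkSum [DecidableEq V] (F : Finset (Finset V)) (x : V → ℝ) (i : V) : ℝ :=
  ∑ e ∈ F with i ∈ e, ∏ v ∈ e.erase i, x v

variable [Fintype V]

open Classical in
/-- The edges of a hypergraph on a finite vertex set, as finsets. -/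
def edges (H : Hypergraph V) : Finset (Finset V) :=
  Finset.univ.filter fun e => (e : Set V) ∈ H.edgeSet

lemma mem_edges {H : Hypergraph V} {e : Finset V} : e ∈ H.edges ↔ (e : Set V) ∈ H.edgeSet := by
  simp [edges]

lemma IsUniform.card_eq {H : Hypergraph V} {k : ℕ} (h : H.IsUniform k) :
    ∀ e ∈ H.edges, e.card = k := fun e he => by
  rw [← Set.ncard_coe_finset, h _ (mem_edges.1 he)]

/-- The number of enumerations of a finset. -/
lemma card_filter_image_eq [DecidableEq V] (S : Finset V) (hS : S.card = n) :
    (Finset.univ.filter fun g : Fin n → V => univ.image g = S).card = n.factorial := by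
  have hc : Fintype.card (Fin n) = Fintype.card S := by simp [hS]
  rw [← Fintype.card_fin n, ← Fintype.card_equiv (Fintype.equivOfCardEq hc), Fintype.card_fin,
    ← Finset.card_univ]
  symm
  refine Finset.card_bij (fun σ _ j => (σ j : V)) ?_ ?_ ?_
  · intro σ _
    simp only [mem_filter, mem_univ, true_and]
    ext v
    simp only [mem_image, mem_univ, true_and]
    constructor
    · rintro ⟨j, rfl⟩
      exact (σ j).2
    · intro hv
      exact ⟨σ.symm ⟨v, hv⟩, by simp⟩
  · intro σ _ τ _ h
    ext j
    exact congrFun h j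
  · intro g hg
    simp only [mem_filter, mem_univ, true_and] at hg
    have hmem : ∀ j, g j ∈ S := fun j => hg ▸ mem_image_of_mem g (mem_univ j)
    have hsurj : Function.Surjective fun j => (⟨g j, hmem j⟩ : S) := by
      rintro ⟨v, hv⟩
      rw [← hg] at hv
      obtain ⟨j, _, rfl⟩ := mem_image.1 hv
      exact ⟨j, rfl⟩
    exact ⟨Equiv.ofBijective _ ((Fintype.bijective_iff_surjective_and_card _).2 ⟨hsurj, hc⟩),
      mem_univ _, rfl⟩

lemma sum_filter_image_eq [DecidableEq V] (S : Finset V) (hS : S.card = n) (x : V → ℝ) :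
    ∑ g : Fin n → V with univ.image g = S, ∏ j, x (g j) = n.factorial * ∏ v ∈ S, x v := by
  rw [← card_filter_image_eq S hS, ← nsmul_eq_mul]
  refine Finset.sum_eq_card_nsmul fun g hg => ?_
  simp only [mem_filter, mem_univ, true_and] at hg
  have hinj : Set.InjOn g (univ : Finset (Fin n)) := by
    rw [← Finset.card_image_iff, hg, hS, card_univ, Fintype.card_fin]
  rw [← hg, Finset.prod_image hinj]

/-- Each edge through i comes from the n! enumerations of its other vertices, which cancels the
weight 1 / n!. -/
lemma applyPow_adjacencyTensor [DecidableEq V] (H : Hypergraph V) (hH : H.IsUniform (n + 1))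
    (x : V → ℝ) (i : V) :
    RealTensor.applyPow (H.adjacencyTensor (n + 1)) x i = linkSum H.edges x i := by
  have hn : (n.factorial : ℝ) ≠ 0 := by positivity
  have hrange : ∀ g : Fin n → V,
      Set.range (Fin.cons i g : Fin (n + 1) → V) = ((insert i (univ.image g) : Finset V) : Set V) := by
    intro g
    rw [Fin.range_cons]
    simp
  have key : RealTensor.applyPow (H.adjacencyTensor (n + 1)) x i =
      ∑ g : Fin n → V with insert i (univ.image g) ∈ H.edges,
        (n.factorial : ℝ)⁻¹ * ∏ j, x (g j) := by
    rw [RealTensor.applyPow_succ, Finset.sum_filter]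
    refine Finset.sum_congr rfl fun g _ => ?_
    simp only [adjacencyTensor, ← mem_edges, hrange]
    split_ifs <;> simp
  rw [key, linkSum, ← Finset.sum_fiberwise_of_maps_to
    (t := H.edges.filter fun e => i ∈ e) (g := fun g : Fin n → V => insert i (univ.image g))]
  · refine Finset.sum_congr rfl fun e he => ?_
    obtain ⟨heE, hie⟩ := mem_filter.1 he
    have hec := hH.card_eq e heE
    have : (univ.filter fun g : Fin n → V => insert i (univ.image g) ∈ H.edges).filter
        (fun g => insert i (univ.image g) = e) = univ.filter fun g => univ.image g = e.erase i := by
      ext g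
      simp only [mem_filter, mem_univ, true_and]
      rw [insert_image_eq_iff hec hie]
      refine ⟨fun h => h.2, fun h => ⟨?_, h⟩⟩
      rwa [h, insert_erase hie]
    rw [this, ← Finset.mul_sum, sum_filter_image_eq _ (by rw [card_erase_of_mem hie, hec]; rfl),
      inv_mul_cancel_left₀ hn]
  · intro g hg
    exact mem_filter.2 ⟨(mem_filter.1 hg).2, mem_insert_self _ _⟩

lemma applyPow_laplacianTensor [DecidableEq V] (H : Hypergraph V) (hH : H.IsUniform (n + 1))
    (x : V → ℝ) (i : V) : RealTensor.applyPow (H.laplacianTensor (n + 1)) x i =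
      H.degree i * x i ^ n - linkSum H.edges x i := by
  rw [laplacianTensor, RealTensor.applyPow_sub, applyPow_adjacencyTensor H hH, degreeTensor,
    RealTensor.applyPow_diagonalTensor]

lemma applyPow_signlessLaplacianTensor [DecidableEq V] (H : Hypergraph V)
    (hH : H.IsUniform (n + 1)) (x : V → ℝ) (i : V) :
    RealTensor.applyPow (H.signlessLaplacianTensor (n + 1)) x i =
      H.degree i * x i ^ n + linkSum H.edges x i := by
  rw [signlessLaplacianTensor, RealTensor.applyPow_add, applyPow_adjacencyTensor H hH, degreeTensor,
    RealTensor.applyPow_diagonalTensor]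

end Edges

/-! ### The form of the signless Laplacian tensor on nonnegative vectors -/

section Form

lemma sum_pow_pos {V : Type*} [Fintype V] {n : ℕ} {x : V → ℝ} (hx : ∀ v, 0 ≤ x v) (h0 : x ≠ 0) : 0 < ∑ v, x v ^ (n + 1) := by
  obtain ⟨i, hi⟩ := Function.ne_iff.1 h0
  exact Finset.sum_pos' (fun v _ => pow_nonneg (hx v) _)
    ⟨i, mem_univ _, pow_pos (lt_of_le_of_ne (hx i) (Ne.symm hi)) _⟩

/-- The homogeneous form of degree `n + 1` attached to the diagonal `d` and the edge set `F`. -/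
def form {V : Type*} [Fintype V] (n : ℕ) (d : V → ℝ) (F : Finset (Finset V)) (x : V → ℝ) : ℝ :=
  ∑ i, d i * x i ^ (n + 1) + (n + 1) * ∑ e ∈ F, ∏ v ∈ e, x v

lemma form_smul {V : Type*} [Fintype V] {n : ℕ} {F : Finset (Finset V)} {d : V → ℝ}
    (hF : ∀ e ∈ F, e.card = n + 1) (c : ℝ) (x : V → ℝ) :
    form n d F (c • x) = c ^ (n + 1) * form n d F x := by
  have h : ∑ e ∈ F, ∏ v ∈ e, (c • x) v = c ^ (n + 1) * ∑ e ∈ F, ∏ v ∈ e, x v := by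
    rw [Finset.mul_sum]
    refine Finset.sum_congr rfl fun e he => ?_
    simp only [Pi.smul_apply, smul_eq_mul, Finset.prod_mul_distrib, prod_const, hF e he]
  have h' : ∑ i, d i * (c • x) i ^ (n + 1) = c ^ (n + 1) * ∑ i, d i * x i ^ (n + 1) := by
    rw [Finset.mul_sum]
    exact Finset.sum_congr rfl fun i _ => by rw [Pi.smul_apply, smul_eq_mul]; ring
  rw [form, form, h, h']
  ring

/-- `ρ` bounds the form on nonnegative vectors. -/
def IsFormBound {V : Type*} [Fintype V] (n : ℕ) (d : V → ℝ) (F : Finset (Finset V)) (ρ : ℝ) : Prop :=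
  ∀ x : V → ℝ, (∀ v, 0 ≤ x v) → form n d F x ≤ ρ * ∑ v, x v ^ (n + 1)

lemma exists_isFormBound {V : Type*} [Fintype V] [Nonempty V] {n : ℕ} {F : Finset (Finset V)}
    (hF : ∀ e ∈ F, e.card = n + 1) (d : V → ℝ) :
    ∃ ρ, IsFormBound n d F ρ ∧ ∃ y : V → ℝ, y ≠ 0 ∧ (∀ v, 0 ≤ y v) ∧
      form n d F y = ρ * ∑ v, y v ^ (n + 1) := by
  let S : Set (V → ℝ) := Metric.sphere 0 1 ∩ {x | ∀ v, 0 ≤ x v}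
  have hS : IsCompact S := by
    refine (isCompact_sphere _ _).inter_right ?_
    simp only [Set.ofPred_forall]
    exact isClosed_iInter fun v => isClosed_le continuous_const (continuous_apply v)
  have hS0 : ∀ x ∈ S, x ≠ 0 := by
    rintro x ⟨hx, _⟩ rfl
    simp at hx
  have hne : S.Nonempty := by
    -- The norm is the sup norm, so the constant vector 1 lies on the unit sphere.
    refine ⟨fun _ => 1, ?_, fun _ => zero_le_one⟩
    simp
  have hcont : ContinuousOn (fun x => form n d F x / ∑ v, x v ^ (n + 1)) S := by
    refine ContinuousOn.div ?_ (by fun_prop) fun x hx => (sum_pow_pos hx.2 (hS0 x hx)).ne'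
    unfold form
    fun_prop
  obtain ⟨y, hy, hmax⟩ := hS.exists_isMaxOn hne hcont
  refine ⟨form n d F y / ∑ v, y v ^ (n + 1), ?_, y, hS0 y hy, hy.2, ?_⟩
  · intro x hx
    by_cases hx0 : x = 0
    · subst hx0
      have : form n d F (0 : V → ℝ) = 0 := by
        have := form_smul (d := d) hF 0 (0 : V → ℝ)
        simpa using this
      simp [this]
    · have hnx : ‖x‖ ≠ 0 := norm_ne_zero_iff.2 hx0
      have hu : ‖x‖⁻¹ • x ∈ S := by
        refine ⟨?_, fun v => ?_⟩
        · rw [mem_sphere_zero_iff_norm, norm_smul, norm_inv, norm_norm, inv_mul_cancel₀ hnx]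
        · exact mul_nonneg (inv_nonneg.2 (norm_nonneg _)) (hx v)
      have h := hmax hu
      simp only [Set.mem_ofPred_eq, form_smul hF, Pi.smul_apply, smul_eq_mul, mul_pow] at h
      rw [← Finset.mul_sum, mul_div_mul_left _ _ (pow_ne_zero _ (inv_ne_zero hnx)),
        div_le_iff₀ (sum_pow_pos hx hx0)] at h
      exact h
  · rw [div_mul_cancel₀ _ (sum_pow_pos hy.2 (hS0 y hy)).ne']

variable {V : Type*} [DecidableEq V] {n : ℕ} {F : Finset (Finset V)} {d : V → ℝ} {ρ : ℝ}

lemma mul_linkSum (F : Finset (Finset V)) (x : V → ℝ) (i : V) :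
    x i * linkSum F x i = ∑ e ∈ F with i ∈ e, ∏ v ∈ e, x v := by
  rw [linkSum, Finset.mul_sum]
  exact Finset.sum_congr rfl fun e he => Finset.mul_prod_erase _ _ (mem_filter.1 he).2

lemma linkSum_nonneg {x : V → ℝ} (hx : ∀ v, 0 ≤ x v) (i : V) : 0 ≤ linkSum F x i :=
  Finset.sum_nonneg fun _ _ => Finset.prod_nonneg fun _ _ => hx _

lemma abs_linkSum_le (x : V → ℝ) (i : V) : |linkSum F x i| ≤ linkSum F (fun v => |x v|) i := by
  refine (Finset.abs_sum_le_sum_abs _ _).trans_eq ?_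
  simp only [Finset.abs_prod, linkSum]

/-- The edge sum is affine in each coordinate, with slope `linkSum`. -/
lemma sum_prod_update (F : Finset (Finset V)) (x : V → ℝ) (i : V) (s : ℝ) :
    ∑ e ∈ F, ∏ v ∈ e, Function.update x i s v =
      ∑ e ∈ F, ∏ v ∈ e, x v + (s - x i) * linkSum F x i := by
  rw [linkSum, Finset.mul_sum, Finset.sum_filter, ← Finset.sum_add_distrib]
  refine Finset.sum_congr rfl fun e _ => ?_
  split_ifs with h
  · rw [Finset.prod_update_of_mem h, ← Finset.mul_prod_erase e x h, Finset.sdiff_singleton_eq_erase]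
    ring
  · rw [Finset.prod_update_of_notMem h, add_zero]

variable [Fintype V]

/-- Euler's identity: each edge is counted once for each of its n + 1 vertices. -/
lemma sum_mul_linkSum (hF : ∀ e ∈ F, e.card = n + 1) (x : V → ℝ) :
    ∑ i, x i * linkSum F x i = (n + 1) * ∑ e ∈ F, ∏ v ∈ e, x v := by
  simp only [mul_linkSum, Finset.sum_filter]
  rw [Finset.sum_comm, Finset.mul_sum]
  refine Finset.sum_congr rfl fun e he => ?_
  rw [← Finset.sum_filter, Finset.sum_const, nsmul_eq_mul, Finset.filter_mem_eq_inter,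
    Finset.univ_inter, hF e he]
  push_cast
  ring

lemma IsFormBound.update_le (hρ : IsFormBound n d F ρ) {y : V → ℝ} (hy : ∀ v, 0 ≤ y v)
    (heq : form n d F y = ρ * ∑ v, y v ^ (n + 1)) (i : V) {s : ℝ} (hs : 0 ≤ s) :
    (n + 1) * ((s - y i) * linkSum F y i) ≤ (ρ - d i) * (s ^ (n + 1) - y i ^ (n + 1)) := by
  have h := hρ (Function.update y i s) fun v => by
    rw [Function.update_apply]; split_ifs; exacts [hs, hy v]
  have hsum : ∀ c : V → ℝ, ∑ v, c v * Function.update y i s v ^ (n + 1) =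
      ∑ v, c v * y v ^ (n + 1) + c i * (s ^ (n + 1) - y i ^ (n + 1)) := by
    intro c
    rw [← Finset.add_sum_erase _ _ (mem_univ i), ← Finset.add_sum_erase _ _ (mem_univ i),
      Function.update_self, Finset.sum_congr rfl (g := fun v => c v * y v ^ (n + 1))]
    · ring
    · intro v hv
      rw [Function.update_of_ne (mem_erase.1 hv).1]
  have h1 := hsum fun _ => 1
  simp only [one_mul] at h1
  rw [form, sum_prod_update, hsum, h1] at h
  rw [form] at heq
  linarith

/-- Maximizers satisfy the eigenvalue equation. -/
lemma IsFormBound.eigen_of_form_eq (hn : n ≠ 0) (hρ : IsFormBound n d F ρ) {y : V → ℝ}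
    (hy : ∀ v, 0 ≤ y v) (heq : form n d F y = ρ * ∑ v, y v ^ (n + 1)) (i : V) :
    d i * y i ^ n + linkSum F y i = ρ * y i ^ n := by
  have key := fun s hs => hρ.update_le hy heq i (s := s) hs
  have hn1 : (0 : ℝ) < n + 1 := by positivity
  rcases (hy i).eq_or_lt with h0 | h0
  · rw [← h0, zero_pow hn, mul_zero, mul_zero, zero_add]
    refine le_antisymm ?_ (linkSum_nonneg hy i)
    have hlim : Filter.Tendsto (fun s : ℝ => (ρ - d i) * s ^ n) (nhdsWithin 0 (Set.Ioi 0))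
        (nhds 0) := by
      have : Continuous fun s : ℝ => (ρ - d i) * s ^ n := by fun_prop
      have h := (this.tendsto 0).mono_left (nhdsWithin_le_nhds (s := Set.Ioi 0))
      simpa [hn] using h
    -- At the boundary y i = 0 only s > 0 is available: divide the inequality by s and let s tend to
    -- 0.
    have : (n + 1) * linkSum F y i ≤ 0 := by
      refine ge_of_tendsto hlim ?_
      filter_upwards [self_mem_nhdsWithin] with s hs
      have hs : 0 < s := hs
      have h := key s hs.le
      rw [← h0, zero_pow (Nat.succ_ne_zero n), sub_zero, sub_zero, pow_succ] at h
      refine le_of_mul_le_mul_right ?_ hs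
      linarith
    nlinarith
  -- In the interior, the gap in `key` is nonnegative near y i and vanishes there, so its derivative
  -- is zero.
  · have hmin : IsLocalMin (fun s : ℝ => (ρ - d i) * (s ^ (n + 1) - y i ^ (n + 1)) -
        (n + 1) * ((s - y i) * linkSum F y i)) (y i) := by
      filter_upwards [lt_mem_nhds h0] with s hs
      have := key s hs.le
      simp only [sub_self, mul_zero, zero_mul]
      linarith
    have hder : HasDerivAt (fun s : ℝ => (ρ - d i) * (s ^ (n + 1) - y i ^ (n + 1)) -
        (n + 1) * ((s - y i) * linkSum F y i))
        ((ρ - d i) * ((n + 1 : ℕ) * y i ^ n) - (n + 1) * (1 * linkSum F y i)) (y i) :=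
      (((hasDerivAt_pow (n + 1) (y i)).sub_const _).const_mul _).sub
        ((((hasDerivAt_id _).sub_const _).mul_const _).const_mul _)
    have h := hmin.hasDerivAt_eq_zero hder
    push_cast at h
    have h' : (n + 1 : ℝ) * ((ρ - d i) * y i ^ n - linkSum F y i) = 0 := by linarith
    have := (mul_eq_zero.1 h').resolve_left hn1.ne'
    linarith

/-- If no proper nonempty set of vertices is separated by the edges, maximizers are positive. -/
lemma IsFormBound.pos_of_form_eq (hF : ∀ e ∈ F, e.card = n + 1) (hρ : IsFormBound n d F ρ)
    (hconn : ∀ Z : Set V, Z.Nonempty → Zᶜ.Nonempty → ∃ e ∈ F, (∃ v ∈ e, v ∈ Z) ∧ ∃ v ∈ e, v ∉ Z)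
    {y : V → ℝ} (hy0 : y ≠ 0) (hy : ∀ v, 0 ≤ y v)
    (heq : form n d F y = ρ * ∑ v, y v ^ (n + 1)) (i : V) : 0 < y i := by
  by_contra hi
  have hi0 : y i = 0 := le_antisymm (not_lt.1 hi) (hy i)
  obtain ⟨j, hj⟩ := Function.ne_iff.1 hy0
  obtain ⟨e, heF, ⟨a, hae, ha⟩, ⟨b, hbe, hb⟩⟩ := hconn {v | y v = 0} ⟨i, hi0⟩ ⟨j, hj⟩
  have ha : y a = 0 := ha
  have hb : y b ≠ 0 := hb
  -- Raise all zeros of y to t. The diagonal terms change by order t^(n+1), while the edge crossing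
  -- the zero set gains at least t^n * c, which is too much for small t.
  let x : ℝ → V → ℝ := fun t v => if y v = 0 then t else y v
  let C : ℝ := ∑ v, if y v = 0 then ρ - d v else 0
  let c : ℝ := ∏ v ∈ e with y v ≠ 0, y v
  have hc : 0 < c := Finset.prod_pos fun v hv =>
    lt_of_le_of_ne (hy v) (Ne.symm (mem_filter.1 hv).2)
  have hprod : ∀ t, ∏ v ∈ e, x t v = t ^ (e.filter fun v => y v = 0).card * c := by
    intro t
    simp only [x, Finset.prod_ite, prod_const]
    rfl
  -- The vertex b of e lies outside the zero set, so the exponent of t is at most n.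
  have hcard : (e.filter fun v => y v = 0).card ≤ n := by
    rw [← Nat.lt_succ_iff, Nat.succ_eq_add_one, ← hF e heF]
    exact Finset.card_lt_card (Finset.filter_ssubset.2 ⟨b, hbe, hb⟩)
  have main : ∀ t : ℝ, 0 < t → t ≤ 1 → c ≤ C * t := by
    intro t ht ht1
    have hx : ∀ v, y v ≤ x t v := by
      intro v
      simp only [x]
      split_ifs with h
      · rw [h]; exact ht.le
      · exact le_rfl
    have h := hρ (x t) fun v => (hy v).trans (hx v)
    have hdiag : ρ * ∑ v, x t v ^ (n + 1) - ∑ v, d v * x t v ^ (n + 1) =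
        ρ * ∑ v, y v ^ (n + 1) - ∑ v, d v * y v ^ (n + 1) + C * t ^ (n + 1) := by
      simp only [C, Finset.mul_sum, Finset.sum_mul]
      rw [← Finset.sum_sub_distrib, ← Finset.sum_sub_distrib, ← Finset.sum_add_distrib]
      refine Finset.sum_congr rfl fun v _ => ?_
      simp only [x]
      split_ifs with hv
      · rw [hv, zero_pow (Nat.succ_ne_zero n)]; ring
      · ring
    have hedge : ∑ e ∈ F, ∏ v ∈ e, y v + t ^ n * c ≤ ∑ e ∈ F, ∏ v ∈ e, x t v := by
      rw [← Finset.add_sum_erase _ _ heF, ← Finset.add_sum_erase _ _ heF, hprod,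
        Finset.prod_eq_zero hae ha]
      have h1 : t ^ n * c ≤ t ^ (e.filter fun v => y v = 0).card * c :=
        mul_le_mul_of_nonneg_right (pow_le_pow_of_le_one ht.le ht1 hcard) hc.le
      have h2 : ∑ e ∈ F.erase e, ∏ v ∈ e, y v ≤ ∑ e ∈ F.erase e, ∏ v ∈ e, x t v :=
        Finset.sum_le_sum fun e _ => Finset.prod_le_prod (fun v _ => hy v) fun v _ => hx v
      linarith
    have hn1 : (1 : ℝ) ≤ n + 1 := by
      have : (0 : ℝ) ≤ n := Nat.cast_nonneg n
      linarith
    have htc : 0 < t ^ n * c := mul_pos (pow_pos ht n) hc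
    rw [form] at h heq
    have h3 : (n + 1 : ℝ) * (∑ e ∈ F, ∏ v ∈ e, y v + t ^ n * c) ≤
        (n + 1) * ∑ e ∈ F, ∏ v ∈ e, x t v := mul_le_mul_of_nonneg_left hedge (by linarith)
    have h4 : t ^ n * c ≤ (n + 1) * (t ^ n * c) := le_mul_of_one_le_left htc.le hn1
    rw [mul_add] at h3
    have h5 : t ^ n * c ≤ t ^ n * (C * t) := by
      have : t ^ n * (C * t) = C * t ^ (n + 1) := by ring
      linarith
    exact le_of_mul_le_mul_left h5 (pow_pos ht n)
  have hlim : Filter.Tendsto (fun t : ℝ => C * t) (nhdsWithin 0 (Set.Ioi 0)) (nhds 0) := by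
    have : Continuous fun t : ℝ => C * t := by fun_prop
    have h := (this.tendsto 0).mono_left (nhdsWithin_le_nhds (s := Set.Ioi 0))
    simpa using h
  have : c ≤ 0 := by
    refine ge_of_tendsto hlim ?_
    filter_upwards [Ioc_mem_nhdsGT (zero_lt_one (α := ℝ))] with t ht
    exact main t ht.1 ht.2
  linarith

/-- The hypothesis forgets the sign of `linkSum`, so it covers eigenvectors of both L and Q. -/
lemma le_form_abs (hF : ∀ e ∈ F, e.card = n + 1) {μ : ℝ} {x : V → ℝ}
    (h : ∀ i, |(μ - d i) * x i ^ n| = |linkSum F x i|) :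
    μ * ∑ v, |x v| ^ (n + 1) ≤ form n d F fun v => |x v| := by
  have key : ∀ i, (μ - d i) * |x i| ^ (n + 1) ≤ |x i| * linkSum F (fun v => |x v|) i := by
    intro i
    calc (μ - d i) * |x i| ^ (n + 1) = |x i| * ((μ - d i) * |x i ^ n|) := by
          rw [abs_pow]; ring
      _ ≤ |x i| * |(μ - d i) * x i ^ n| := by
          rw [abs_mul]
          gcongr
          exact le_abs_self _
      _ ≤ _ := by
          rw [h]
          gcongr
          exact abs_linkSum_le x i
  have := Finset.sum_le_sum fun i (_ : i ∈ univ) => key i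
  rw [sum_mul_linkSum hF] at this
  simp only [sub_mul, Finset.sum_sub_distrib, ← Finset.mul_sum] at this
  rw [form]
  linarith

lemma IsFormBound.le_of_eigen (hF : ∀ e ∈ F, e.card = n + 1) (hρ : IsFormBound n d F ρ) {μ : ℝ}
    {x : V → ℝ} (hx : x ≠ 0) (h : ∀ i, |(μ - d i) * x i ^ n| = |linkSum F x i|) : μ ≤ ρ := by
  have hx0 : (fun v => |x v|) ≠ 0 := fun h0 => hx (by
    funext v; exact abs_eq_zero.1 (congrFun h0 v))
  exact le_of_mul_le_mul_right
    ((le_form_abs hF h).trans (hρ (fun v => |x v|) fun v => abs_nonneg _))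
    (sum_pow_pos (fun v => abs_nonneg _) hx0)

end Form

/-! ### Sign patterns -/

section Sign

lemma prod_eq_neg_one_pow_mul_prod_abs {V : Type*} (e : Finset V) (x : V → ℝ) :
    ∏ v ∈ e, x v = (-1) ^ (e.filter fun v => x v < 0).card * ∏ v ∈ e, |x v| := by
  have : ∏ v ∈ e, (if x v < 0 then (-1 : ℝ) else 1) = (-1) ^ (e.filter fun v => x v < 0).card := by
    rw [Finset.prod_ite, prod_const, prod_const_one, mul_one]
  rw [← this, ← Finset.prod_mul_distrib]
  refine Finset.prod_congr rfl fun v _ => ?_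
  split_ifs with h
  · rw [abs_of_neg h]; ring
  · rw [abs_of_nonneg (not_lt.1 h), one_mul]

variable {V : Type*} [DecidableEq V] {n : ℕ} {F : Finset (Finset V)}

lemma eq_neg_abs_of_sum_eq {ι : Type*} {s : Finset ι} {f : ι → ℝ}
    (h : -∑ i ∈ s, f i = ∑ i ∈ s, |f i|) : ∀ i ∈ s, f i = -|f i| := by
  have h0 : ∑ i ∈ s, (|f i| + f i) = 0 := by rw [Finset.sum_add_distrib]; linarith
  rw [Finset.sum_eq_zero_iff_of_nonneg fun i _ => by linarith [neg_abs_le (f i)]] at h0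
  intro i hi
  linarith [h0 i hi]

/-- After multiplication by x i, evenness makes the left sides of `h₁` and `h₂` agree, so the edge
products through i attain equality in the triangle inequality with negative sign. -/
lemma prod_neg_of_linkSum_eq_neg {x : V → ℝ} (hx : ∀ v, x v ≠ 0) {c : V → ℝ} (hk : Even (n + 1))
    (h₁ : ∀ i, c i * x i ^ n = -linkSum F x i)
    (h₂ : ∀ i, c i * |x i| ^ n = linkSum F (fun v => |x v|) i) {e : Finset V} (he : e ∈ F)
    (hne : e.Nonempty) : ∏ v ∈ e, x v < 0 := by
  obtain ⟨i, hi⟩ := hne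
  have h : -∑ e ∈ F with i ∈ e, ∏ v ∈ e, x v = ∑ e ∈ F with i ∈ e, |∏ v ∈ e, x v| := by
    simp only [Finset.abs_prod]
    rw [← mul_linkSum, ← mul_linkSum F (fun v => |x v|), ← h₂, ← mul_neg, ← h₁]
    have := hk.pow_abs (x i)
    rw [pow_succ, pow_succ] at this
    linear_combination -c i * this
  rw [eq_neg_abs_of_sum_eq h e (mem_filter.2 ⟨he, hi⟩)]
  exact neg_neg_of_pos (abs_pos.2 (Finset.prod_ne_zero_iff.2 fun v _ => hx v))

/-- Now n is even, so the left sides agree without multiplying by x i, and every product over e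
without i is negative. There are n + 1 of these, an odd number, so their product is negative; yet it
equals the n-th power of the product over e, which is nonnegative. -/
lemma linkSum_ne_neg_of_odd {x : V → ℝ} (hx : ∀ v, x v ≠ 0) {c : V → ℝ} (hk : Odd (n + 1))
    (h₁ : ∀ i, c i * x i ^ n = -linkSum F x i)
    (h₂ : ∀ i, c i * |x i| ^ n = linkSum F (fun v => |x v|) i) {e : Finset V} (he : e ∈ F)
    (hc : e.card = n + 1) : False := by
  have hn : Even n := by
    rcases Nat.even_or_odd n with h | h
    · exact h
    · exact absurd h.add_one (Nat.not_even_iff_odd.2 hk)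
  have hneg : ∀ i ∈ e, ∏ v ∈ e.erase i, x v < 0 := by
    intro i hi
    have h : -∑ e ∈ F with i ∈ e, ∏ v ∈ e.erase i, x v =
        ∑ e ∈ F with i ∈ e, |∏ v ∈ e.erase i, x v| := by
      simp only [Finset.abs_prod]
      change -linkSum F x i = linkSum F (fun v => |x v|) i
      rw [← h₂, ← h₁, hn.pow_abs]
    rw [eq_neg_abs_of_sum_eq h e (mem_filter.2 ⟨he, hi⟩)]
    exact neg_neg_of_pos (abs_pos.2 (Finset.prod_ne_zero_iff.2 fun v _ => hx v))
  have hprod : (∏ i ∈ e, x i) * ∏ i ∈ e, ∏ v ∈ e.erase i, x v = (∏ v ∈ e, x v) ^ (n + 1) := by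
    rw [← Finset.prod_mul_distrib, Finset.prod_congr rfl fun i hi => Finset.mul_prod_erase e x hi,
      prod_const, hc]
  have h0 : ∏ v ∈ e, x v ≠ 0 := Finset.prod_ne_zero_iff.2 fun v _ => hx v
  have h1 : ∏ i ∈ e, ∏ v ∈ e.erase i, x v = (∏ v ∈ e, x v) ^ n := by
    refine mul_left_cancel₀ h0 ?_
    rw [hprod, pow_succ']
  have h2 : ∏ i ∈ e, ∏ v ∈ e.erase i, x v < 0 := by
    have h3 : ∏ i ∈ e, -∏ v ∈ e.erase i, x v = (-1) ^ e.card * ∏ i ∈ e, ∏ v ∈ e.erase i, x v := by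
      rw [Finset.prod_neg]
    have h4 : 0 < ∏ i ∈ e, -∏ v ∈ e.erase i, x v :=
      Finset.prod_pos fun i hi => neg_pos.2 (hneg i hi)
    rw [h3, hc, hk.neg_one_pow] at h4
    linarith
  exact absurd (hn.pow_nonneg (∏ v ∈ e, x v)) (by rw [← h1]; exact not_le.2 h2)

lemma linkSum_sign_mul {s : V → ℝ} (hs : ∀ v, s v * s v = 1) (hF : ∀ e ∈ F, ∏ v ∈ e, s v = -1)
    (x : V → ℝ) (i : V) : linkSum F (fun v => s v * x v) i = -(s i * linkSum F x i) := by
  rw [linkSum, linkSum, Finset.mul_sum, ← Finset.sum_neg_distrib]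
  refine Finset.sum_congr rfl fun e he => ?_
  obtain ⟨heF, hi⟩ := mem_filter.1 he
  have h := hF e heF
  rw [← Finset.mul_prod_erase e s hi] at h
  have h' : ∏ v ∈ e.erase i, s v = -s i := by
    linear_combination s i * h - (∏ v ∈ e.erase i, s v) * hs i
  rw [Finset.prod_mul_distrib, h']
  ring

end Sign

/-! ### Connectedness and odd-bipartiteness -/

section Edges

variable {V : Type*}

/-- If no edge crossed Z, a chain of edges starting in Z would stay inside Z. -/
lemma IsConnected.exists_mem_notMem {H : Hypergraph V} (hV : H.vertexSet = Set.univ)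
    (hH : H.IsConnected) {Z : Set V} (h₁ : Z.Nonempty) (h₂ : Zᶜ.Nonempty) :
    ∃ e ∈ H.edgeSet, (∃ v ∈ e, v ∈ Z) ∧ ∃ v ∈ e, v ∉ Z := by
  obtain ⟨i, hi⟩ := h₁
  obtain ⟨j, hj⟩ := h₂
  obtain ⟨m, e, he, hie, hje, hne⟩ := hH i (hV ▸ Set.mem_univ i) j (hV ▸ Set.mem_univ j)
    (fun h => hj (h ▸ hi))
  by_contra! hcon
  have hsub : ∀ r ≤ m, ∀ v ∈ e r, v ∈ Z := by
    intro r
    induction r with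
    | zero => exact fun h => hcon _ (he 0 h) ⟨i, hie, hi⟩
    | succ r ih =>
      intro h
      obtain ⟨w, hw, hw'⟩ := hne r h
      exact hcon _ (he _ h) ⟨w, hw', ih (by omega) w hw⟩
  exact hj (hsub m le_rfl j hje)

lemma IsConnected.edgeSet_nonempty [Nontrivial V] {H : Hypergraph V}
    (hV : H.vertexSet = Set.univ) (hH : H.IsConnected) : H.edgeSet.Nonempty := by
  obtain ⟨i, j, hij⟩ := exists_pair_ne V
  obtain ⟨e, he, -⟩ := hH.exists_mem_notMem hV (Set.singleton_nonempty i) ⟨j, hij.symm⟩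
  exact ⟨e, he⟩

variable [Fintype V]

lemma exists_mem_edges {H : Hypergraph V} {e : Set V} (he : e ∈ H.edgeSet) :
    ∃ f ∈ H.edges, (f : Set V) = e := by
  classical
  exact ⟨e.toFinset, mem_edges.2 (by simpa using he), by simp⟩

lemma isOddBipartite_of_prod_neg {H : Hypergraph V} {k : ℕ} (hV : H.vertexSet = Set.univ)
    (hH : H.IsUniform k) (hk : Even k) {x : V → ℝ}
    (hx : ∀ e ∈ H.edges, ∏ v ∈ e, x v < 0) : H.IsOddBipartite := by
  classical
  have hodd : ∀ e ∈ H.edges, Odd (e.filter fun v => x v < 0).card := by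
    intro e he
    by_contra h
    have h0 := hx e he
    rw [prod_eq_neg_one_pow_mul_prod_abs, (Nat.not_odd_iff_even.1 h).neg_one_pow, one_mul] at h0
    exact absurd (Finset.prod_nonneg fun v _ => abs_nonneg (x v)) (not_le.2 h0)
  rcases Set.eq_empty_or_nonempty H.edgeSet with h | ⟨e, he⟩
  · exact Or.inl h
  obtain ⟨f, hf, -⟩ := exists_mem_edges he
  refine Or.inr ⟨{v | x v < 0}, {v | x v < 0}ᶜ, ?_, ?_, disjoint_compl_right, ?_, ?_⟩
  · obtain ⟨v, hv⟩ := Finset.card_pos.1 (hodd f hf).pos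
    exact ⟨v, (mem_filter.1 hv).2⟩
  -- If all entries were negative, an edge would meet the first part in all of its k vertices, an
  -- even number.
  · by_contra hcon
    rw [Set.not_nonempty_iff_eq_empty, Set.compl_empty_iff] at hcon
    have h1 : f.filter (fun v => x v < 0) = f :=
      Finset.filter_true_of_mem fun v _ => (hcon ▸ Set.mem_univ v : v ∈ {v | x v < 0})
    have h2 := hodd f hf
    rw [h1, hH.card_eq f hf] at h2
    exact Nat.not_odd_iff_even.2 hk h2
  · rw [Set.union_compl_self, hV]
  · intro e he
    obtain ⟨f, hf, rfl⟩ := exists_mem_edges he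
    have : (f : Set V) ∩ {v | x v < 0} = (f.filter fun v => x v < 0 : Finset V) := by
      ext v; simp
    rw [this, Set.ncard_coe_finset]
    exact hodd f hf

lemma IsOddBipartite.exists_sign {H : Hypergraph V} (hH : H.IsOddBipartite) :
    ∃ s : V → ℝ, (∀ v, s v * s v = 1) ∧ ∀ e ∈ H.edges, ∏ v ∈ e, s v = -1 := by
  classical
  rcases hH with h | ⟨V₁, -, -, -, -, -, hodd⟩
  · refine ⟨fun _ => 1, fun _ => one_mul 1, fun e he => ?_⟩
    rw [mem_edges, h] at he
    exact absurd he (Set.notMem_empty _)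
  · refine ⟨fun v => if v ∈ V₁ then -1 else 1, fun v => ?_, fun e he => ?_⟩
    · dsimp only
      split_ifs <;> norm_num
    · have h := hodd _ (mem_edges.1 he)
      have h1 : (e : Set V) ∩ V₁ = (e.filter fun v => v ∈ V₁ : Finset V) := by
        ext v; simp
      rw [h1, Set.ncard_coe_finset] at h
      rw [Finset.prod_ite, prod_const, prod_const_one, mul_one, h.neg_one_pow]

end Edges

/-! ### Largest H-eigenvalues -/

section Eigenvalues

variable {V : Type*} {n : ℕ}

/-- An edge minus one vertex keeps at least two vertices, one of them different from i. This makes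
coordinate vectors eigenvectors of L, so its spectrum is nonempty. -/
lemma linkSum_single_eq_zero [DecidableEq V] {F : Finset (Finset V)} (hn : 2 ≤ n)
    (hF : ∀ e ∈ F, e.card = n + 1) (i j : V) : linkSum F (Pi.single i 1) j = 0 := by
  refine Finset.sum_eq_zero fun e he => ?_
  obtain ⟨heF, hj⟩ := mem_filter.1 he
  have hc : 1 < (e.erase j).card := by
    rw [card_erase_of_mem hj, hF e heF]
    exact hn
  obtain ⟨v, hv, hvi⟩ := Finset.exists_mem_ne hc i
  exact Finset.prod_eq_zero hv (Pi.single_eq_of_ne hvi _)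

variable [Fintype V]

lemma degree_mem_hEigenvalues_laplacianTensor {H : Hypergraph V} (hn : 2 ≤ n)
    (hH : H.IsUniform (n + 1)) (i : V) :
    (H.degree i : ℝ) ∈ (H.laplacianTensor (n + 1)).hEigenvalues := by
  classical
  refine (RealTensor.isHEigenvalue_iff _ _).2 ⟨Pi.single i 1, by simp, fun j => ?_⟩
  rw [applyPow_laplacianTensor H hH, linkSum_single_eq_zero hn hH.card_eq, sub_zero]
  by_cases h : j = i
  · rw [h]
  · rw [Pi.single_eq_of_ne h, zero_pow (by omega), mul_zero, mul_zero]

lemma sub_degree_mul_pow_eq_of_eigen [DecidableEq V] {H : Hypergraph V}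
    (hH : H.IsUniform (n + 1)) {μ : ℝ} {x : V → ℝ}
    (h : ∀ i, RealTensor.applyPow (H.laplacianTensor (n + 1)) x i = μ * x i ^ n) (i : V) :
    (μ - H.degree i) * x i ^ n = -linkSum H.edges x i := by
  have := h i
  rw [applyPow_laplacianTensor H hH] at this
  linarith

/-- Properties of the largest H-eigenvalue of the signless Laplacian tensor. -/
lemma isFormBound_largestHEigenvalue [DecidableEq V] [Nonempty V] {H : Hypergraph V} (hn : n ≠ 0)
    (hH : H.IsUniform (n + 1)) :
    IsGreatest (H.signlessLaplacianTensor (n + 1)).hEigenvalues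
      (H.signlessLaplacianTensor (n + 1)).largestHEigenvalue ∧
    IsFormBound n (fun i => (H.degree i : ℝ)) H.edges
      (H.signlessLaplacianTensor (n + 1)).largestHEigenvalue := by
  obtain ⟨ρ, hρ, y, hy0, hy, heq⟩ := exists_isFormBound hH.card_eq fun i => (H.degree i : ℝ)
  have hgr : IsGreatest (H.signlessLaplacianTensor (n + 1)).hEigenvalues ρ := by
    refine ⟨(RealTensor.isHEigenvalue_iff _ _).2 ⟨y, hy0, fun i => ?_⟩, fun μ hμ => ?_⟩
    · rw [applyPow_signlessLaplacianTensor H hH]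
      exact hρ.eigen_of_form_eq hn hy heq i
    · obtain ⟨x, hx, h⟩ := (RealTensor.isHEigenvalue_iff _ _).1 hμ
      refine hρ.le_of_eigen hH.card_eq hx fun i => ?_
      have := h i
      rw [applyPow_signlessLaplacianTensor H hH] at this
      congr 1
      linarith
  rw [RealTensor.largestHEigenvalue, hgr.csSup_eq]
  exact ⟨hgr, hρ⟩

/-- Multiply the eigenvector by the signs of the bipartition: `linkSum` picks up -s i, while the
diagonal term picks up s i ^ n = s i because n is odd. -/
lemma mem_hEigenvalues_laplacianTensor_of_isOddBipartite {H : Hypergraph V}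
    (hH : H.IsUniform (n + 1)) (hk : Even (n + 1)) (hodd : H.IsOddBipartite) {μ : ℝ}
    (hμ : μ ∈ (H.signlessLaplacianTensor (n + 1)).hEigenvalues) :
    μ ∈ (H.laplacianTensor (n + 1)).hEigenvalues := by
  classical
  obtain ⟨s, hs, hprod⟩ := hodd.exists_sign
  obtain ⟨x, hx, h⟩ := (RealTensor.isHEigenvalue_iff _ _).1 hμ
  have hsn : ∀ v, s v ^ n = s v := by
    intro v
    obtain ⟨m, rfl⟩ : Odd n := by
      by_contra hn
      exact Nat.not_even_iff_odd.2 (Nat.not_odd_iff_even.1 hn).add_one hk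
    rw [pow_succ, pow_mul, sq, hs, one_pow, one_mul]
  refine (RealTensor.isHEigenvalue_iff _ _).2 ⟨fun v => s v * x v, fun h0 => hx ?_, fun i => ?_⟩
  · funext v
    have := congrFun h0 v
    have hsv : s v ≠ 0 := fun h0 => by simpa [h0] using hs v
    exact (mul_eq_zero.1 this).resolve_left hsv
  · have := h i
    rw [applyPow_signlessLaplacianTensor H hH] at this
    rw [applyPow_laplacianTensor H hH, linkSum_sign_mul hs hprod, mul_pow, hsn]
    linear_combination s i * this

/-- If the largest H-eigenvalue of the signless Laplacian tensor of a connected hypergraph is an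
H-eigenvalue of the Laplacian tensor, then the hypergraph is odd-bipartite of even uniformity. -/
lemma even_and_isOddBipartite_of_mem [Nontrivial V] {H : Hypergraph V}
    (hV : H.vertexSet = Set.univ) (hn : n ≠ 0) (hH : H.IsUniform (n + 1)) (hconn : H.IsConnected)
    (hmem : (H.signlessLaplacianTensor (n + 1)).largestHEigenvalue ∈
      (H.laplacianTensor (n + 1)).hEigenvalues) : Even (n + 1) ∧ H.IsOddBipartite := by
  classical
  obtain ⟨-, hρ⟩ := isFormBound_largestHEigenvalue hn hH
  obtain ⟨x, hx, h⟩ := (RealTensor.isHEigenvalue_iff _ _).1 hmem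
  have h₁ := sub_degree_mul_pow_eq_of_eigen hH h
  have hx0 : (fun v => |x v|) ≠ 0 := fun h0 => hx (by
    funext v; exact abs_eq_zero.1 (congrFun h0 v))
  have hxa : ∀ v, 0 ≤ (fun v => |x v|) v := fun v => abs_nonneg (x v)
  -- The eigenvalue is the bound itself, so |x| attains the maximum.
  have heq := le_antisymm (hρ _ hxa)
    (le_form_abs hH.card_eq fun i => by rw [h₁, abs_neg])
  have hpos : ∀ v, x v ≠ 0 := fun v => abs_pos.1 <| hρ.pos_of_form_eq hH.card_eq (by
    intro Z hZ hZ'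
    obtain ⟨e, he, h⟩ := hconn.exists_mem_notMem hV hZ hZ'
    obtain ⟨f, hf, rfl⟩ := exists_mem_edges he
    exact ⟨f, hf, h⟩) hx0 hxa heq v
  have h₂ : ∀ i, ((H.signlessLaplacianTensor (n + 1)).largestHEigenvalue - H.degree i) *
      |x i| ^ n = linkSum H.edges (fun v => |x v|) i := fun i => by
    have := hρ.eigen_of_form_eq hn hxa heq i
    linarith
  have hk : Even (n + 1) := by
    by_contra hk
    obtain ⟨e, he⟩ := hconn.edgeSet_nonempty hV
    obtain ⟨f, hf, -⟩ := exists_mem_edges he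
    exact linkSum_ne_neg_of_odd hpos (Nat.not_even_iff_odd.1 hk) h₁ h₂ hf (hH.card_eq f hf)
  refine ⟨hk, isOddBipartite_of_prod_neg (x := x) hV hH hk fun e he => ?_⟩
  refine prod_neg_of_linkSum_eq_neg hpos hk h₁ h₂ he (Finset.card_pos.1 ?_)
  rw [hH.card_eq e he]
  exact n.succ_pos

end Eigenvalues

end Hypergraph

end

theorem mainTheorem3 {V : Type*} [Fintype V] (k : ℕ) (hk : 3 ≤ k) (hn : k ≤ Fintype.card V)
    (G : Hypergraph V) (hV : G.vertexSet = Set.univ) (hG : G.IsUniform k) :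
    -- the largest H-eigenvalues exist
    IsGreatest (G.laplacianTensor k).hEigenvalues (G.laplacianTensor k).largestHEigenvalue ∧
    IsGreatest (G.signlessLaplacianTensor k).hEigenvalues
      (G.signlessLaplacianTensor k).largestHEigenvalue ∧
    (G.laplacianTensor k).largestHEigenvalue ≤
      (G.signlessLaplacianTensor k).largestHEigenvalue ∧
    (G.IsConnected →
      ((G.laplacianTensor k).largestHEigenvalue =
          (G.signlessLaplacianTensor k).largestHEigenvalue ↔
        Even k ∧ G.IsOddBipartite)) ∧
    (Odd k → G.IsConnected → G.edgeSet.Nonempty →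
      (G.laplacianTensor k).largestHEigenvalue <
        (G.signlessLaplacianTensor k).largestHEigenvalue) := by
  classical
  obtain ⟨n, rfl⟩ : ∃ n, k = n + 1 := ⟨k - 1, by omega⟩
  have hn2 : 2 ≤ n := by omega
  have hn0 : n ≠ 0 := by omega
  have : Nontrivial V := Fintype.one_lt_card_iff_nontrivial.1 (by omega)
  obtain ⟨hQ, hρ⟩ := Hypergraph.isFormBound_largestHEigenvalue hn0 hG
  have hL := Hypergraph.RealTensor.isGreatest_largestHEigenvalue (G.laplacianTensor (n + 1))
    ⟨_, Hypergraph.degree_mem_hEigenvalues_laplacianTensor hn2 hG (Classical.arbitrary V)⟩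
  have hle : (G.laplacianTensor (n + 1)).largestHEigenvalue ≤
      (G.signlessLaplacianTensor (n + 1)).largestHEigenvalue := by
    obtain ⟨x, hx, h⟩ := (Hypergraph.RealTensor.isHEigenvalue_iff _ _).1 hL.1
    refine hρ.le_of_eigen hG.card_eq hx fun i => ?_
    rw [Hypergraph.sub_degree_mul_pow_eq_of_eigen hG h, abs_neg]
  have hfwd : G.IsConnected → (G.laplacianTensor (n + 1)).largestHEigenvalue =
      (G.signlessLaplacianTensor (n + 1)).largestHEigenvalue →
      Even (n + 1) ∧ G.IsOddBipartite := fun hconn heq =>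
    Hypergraph.even_and_isOddBipartite_of_mem hV hn0 hG hconn (heq ▸ hL.1)
  refine ⟨hL, hQ, hle, fun hconn => ⟨hfwd hconn, fun h => le_antisymm hle ?_⟩,
    fun hk hconn _ => lt_of_le_of_ne hle fun h => ?_⟩
  · exact hL.2 (Hypergraph.mem_hEigenvalues_laplacianTensor_of_isOddBipartite hG h.1 h.2 hQ.1)
  · exact Nat.not_even_iff_odd.2 hk (hfwd hconn h).1
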